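/- Let $1<p<\infty$. Let $\ell^p_A$ be the space of power series $f(z)=\sum_{k\ge 0}a_kz^k$ with complex coefficients such that $\|f\|_p:=\bigl(\sum_{k\ge 0}|a_k|^p\bigr)^{1/p}<\infty$, and for an integer $n\ge 1$ let $\mathscr P_n$ be the space of complex polynomials of degree at most $n$. For $f\in\ell^p_A$ with $f(0)\ne 0$, the optimal polynomial approximant $p_{n,f}$ is the unique element of $\mathscr P_n$ with $$\|1-p_{n,f}f\|_p=\inf_{q\in\mathscr P_n}\|1-qf\|_p .$$ Let $\Omega_p\subset\mathbb C$ be the set of all $z_0\in\mathbb C$ for which there exist $f\in\ell^p_A$ with $f(0)\neq 0$ and an integer $n\ge 1$ such that $p_{n,f}(z_0)=0$. Theorem. For every $1<p<\infty$ with $p\ne 2$ there exists $\tau_p\in(1,2)$ such that $$\Omega_p=\mathbb C\setminus\tfrac1{\tau_p}\overline{\mathbb D}=\{z\in\mathbb C:|z|>1/\tau_p\},$$ where $\mathbb D=\{z\in\mathbb C:|z|<1\}$. In particular $\Omega_p\cap\mathbb D=\{z:1/\tau_p<|z|<1\}$, and $\Omega_p$ is open. -/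

import Mathlib

noncomputable section

namespace EllA

open PowerSeries

/-- The space `ℓ^p_A`: power series over `ℂ` whose Taylor coefficients are `p`-summable. -/
def space (p : ℝ) : Set (PowerSeries ℂ) :=
  {f | Summable fun k : ℕ => ‖coeff k f‖ ^ p}

/-- The norm `‖f‖_p = (∑ |a_k|^p)^(1/p)` of a power series `f = ∑ a_k z^k` in `ℓ^p_A`. -/
def pNorm (p : ℝ) (f : PowerSeries ℂ) : ℝ :=
  (∑' k : ℕ, ‖coeff k f‖ ^ p) ^ (1 / p)

/-- The distance from the constant function `1` to `f · 𝒫_n`, where `𝒫_n` is the space of complex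
polynomials of degree at most `n`. -/
def distOne (p : ℝ) (f : PowerSeries ℂ) (n : ℕ) : ℝ :=
  ⨅ r : Polynomial.degreeLE ℂ (n : WithBot ℕ), pNorm p (1 - ((r : Polynomial ℂ) : PowerSeries ℂ) * f)

/-- `q` is the optimal polynomial approximant of `1/f` of degree at most `n` in `ℓ^p_A`:
`q ∈ 𝒫_n` and `‖1 - q f‖_p = dist(1, f · 𝒫_n)`.  (For `1 < p < ∞` and `0 ≠ f ∈ ℓ^p_A` exactly one
`q` has this property.) -/
def IsOPA (p : ℝ) (f : PowerSeries ℂ) (n : ℕ) (q : Polynomial ℂ) : Prop :=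
  q ∈ Polynomial.degreeLE ℂ (n : WithBot ℕ) ∧
    pNorm p (1 - (q : PowerSeries ℂ) * f) = distOne p f n

/-- `Ω_p`: the set of all zeros of the optimal polynomial approximants of degree at most `n`, over
all positive integers `n` and all `f ∈ ℓ^p_A` with `f(0) ≠ 0`. -/
def Omega (p : ℝ) : Set ℂ :=
  {z | ∃ f ∈ space p, constantCoeff f ≠ 0 ∧
    ∃ n : ℕ, 1 ≤ n ∧ ∃ q : Polynomial ℂ, IsOPA p f n q ∧ q.eval z = 0}

end EllA

end

namespace EllA

open Filter Topology ComplexConjugate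

/-! Write `S` for the backward shift. If `q = (X - z) r` is optimal for `f` and `g = r f`, varying
only the coefficient of `X g` shows that `z⁻¹ g` is the best approximation of `S g` by multiples of
`g`. Conversely, any such sequence yields an optimal approximant of degree one vanishing at `z`. So
`Ω_p` is the set of inverses of nonzero points of `shiftRange p` (`mem_Omega_iff`).

It remains to see that `shiftRange p` is, away from 0, an open disc of radius in `(1, 2)`. It is
rotation invariant (`mul_mem_shiftRange`), contains every point of smaller modulus
(`mem_shiftRange_of_norm_le`, by connectedness), and has no nonzero point of maximal modulus
(`exists_norm_lt_mem_shiftRange`). A Clarkson inequality keeps the radius below 2; explicit ramps,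
available because `p ≠ 2`, push it above 1. -/

/-! ### Duality and first-order conditions in `ℓ^p` -/

lemma rpow_norm_add_le {p : ℝ} (hp : 1 ≤ p) (x y : ℂ) :
    ‖x + y‖ ^ p ≤ 2 ^ (p - 1) * (‖x‖ ^ p + ‖y‖ ^ p) := by
  calc ‖x + y‖ ^ p ≤ (‖x‖ + ‖y‖) ^ p :=
        Real.rpow_le_rpow (norm_nonneg _) (norm_add_le _ _) (by linarith)
    _ ≤ _ := by
        exact_mod_cast NNReal.rpow_add_le_mul_rpow_add_rpow ‖x‖₊ ‖y‖₊ hp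

lemma summable_add {p : ℝ} (hp : 1 ≤ p) {a b : ℕ → ℂ} (ha : Summable fun k => ‖a k‖ ^ p)
    (hb : Summable fun k => ‖b k‖ ^ p) : Summable fun k => ‖a k + b k‖ ^ p :=
  Summable.of_nonneg_of_le (fun _ => by positivity) (fun k => rpow_norm_add_le hp (a k) (b k))
    ((ha.add hb).mul_left _)

lemma summable_const_mul {p : ℝ} {a : ℕ → ℂ} (ha : Summable fun k => ‖a k‖ ^ p) (c : ℂ) :
    Summable fun k => ‖c * a k‖ ^ p := by
  simp_rw [norm_mul, Real.mul_rpow (norm_nonneg _) (norm_nonneg _)]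
  exact ha.mul_left _

lemma summable_sub_mul {p : ℝ} (hp : 1 ≤ p) {a b : ℕ → ℂ} (ha : Summable fun k => ‖a k‖ ^ p)
    (hb : Summable fun k => ‖b k‖ ^ p) (s : ℂ) : Summable fun k => ‖a k - s * b k‖ ^ p := by
  simpa [sub_eq_add_neg] using summable_add hp ha (summable_const_mul hb (-s))

/-- The duality map `w ↦ |w|^(p-2) w̄` of the scalar `ℓ^p` norm. -/
noncomputable def dual (p : ℝ) (w : ℂ) : ℂ := ((‖w‖ ^ (p - 2) : ℝ) : ℂ) * conj w

lemma dual_mul_self {p : ℝ} (hp : 1 < p) (w : ℂ) : dual p w * w = ((‖w‖ ^ p : ℝ) : ℂ) := by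
  have h : ‖w‖ ^ p = ‖w‖ ^ (p - 2) * ‖w‖ ^ 2 := by
    rcases eq_or_ne w 0 with rfl | hw
    · simp [Real.zero_rpow (by linarith : p ≠ 0)]
    · rw [← Real.rpow_natCast, ← Real.rpow_add (norm_pos_iff.2 hw)]
      norm_num
  rw [dual, mul_assoc, Complex.conj_mul', h]
  push_cast
  ring

lemma norm_dual {p : ℝ} (hp : 1 < p) (w : ℂ) : ‖dual p w‖ = ‖w‖ ^ (p - 1) := by
  rcases eq_or_ne w 0 with rfl | hw
  · simp [dual, Real.zero_rpow (by linarith : p - 1 ≠ 0)]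
  · rw [dual, norm_mul, Complex.norm_real, Complex.norm_conj, Real.norm_of_nonneg (by positivity),
      show p - 1 = p - 2 + 1 by ring, Real.rpow_add_one (norm_ne_zero_iff.2 hw)]

lemma dual_mul (p : ℝ) (z w : ℂ) : dual p (z * w) = dual p z * dual p w := by
  simp only [dual, norm_mul, Real.mul_rpow (norm_nonneg _) (norm_nonneg _), map_mul]
  push_cast
  ring

@[simp] lemma dual_zero (p : ℝ) : dual p 0 = 0 := by simp [dual]

lemma dual_ofReal (p x : ℝ) : dual p (x : ℂ) = ((|x| ^ (p - 2) * x : ℝ) : ℂ) := by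
  simp [dual]

lemma continuous_dual {p : ℝ} (hp : 1 < p) : Continuous (dual p) := by
  rw [continuous_iff_continuousAt]
  intro w
  rcases eq_or_ne w 0 with rfl | hw
  · rw [ContinuousAt, dual_zero, tendsto_zero_iff_norm_tendsto_zero]
    simp_rw [norm_dual hp]
    have : Continuous fun x : ℂ => ‖x‖ ^ (p - 1) :=
      continuous_norm.rpow_const fun _ => Or.inr (by linarith)
    simpa [Real.zero_rpow (by linarith : p - 1 ≠ 0)] using this.tendsto 0
  · have h : ContinuousAt (fun x : ℂ => ‖x‖ ^ (p - 2)) w :=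
      continuous_norm.continuousAt.rpow_const (Or.inl (norm_ne_zero_iff.2 hw))
    exact (Complex.continuous_ofReal.continuousAt.comp h).mul
      Complex.continuous_conj.continuousAt

lemma exists_dual_eq {p : ℝ} (hp : 1 < p) (v : ℂ) : ∃ w, dual p w = v := by
  rcases eq_or_ne v 0 with rfl | hv
  · exact ⟨0, dual_zero p⟩
  have hv' : 0 < ‖v‖ := norm_pos_iff.2 hv
  have h1 : p - 1 ≠ 0 := by linarith
  -- The modulus must be `‖v‖ ^ (1 / (p - 1))`, and `1 / (p - 1) = 1 + (2 - p) / (p - 1)`.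
  refine ⟨((‖v‖ ^ ((2 - p) / (p - 1)) : ℝ) : ℂ) * conj v, ?_⟩
  have h : (‖v‖ ^ ((2 - p) / (p - 1)) * ‖v‖) ^ (p - 2) * ‖v‖ ^ ((2 - p) / (p - 1)) = 1 := by
    rw [← Real.rpow_add_one hv'.ne', ← Real.rpow_mul hv'.le, ← Real.rpow_add hv',
      show ((2 - p) / (p - 1) + 1) * (p - 2) + (2 - p) / (p - 1) = 0 by field_simp; ring,
      Real.rpow_zero]
  rw [dual, norm_mul, Complex.norm_real, Complex.norm_conj, Real.norm_of_nonneg (by positivity),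
    map_mul, Complex.conj_ofReal, Complex.conj_conj, ← mul_assoc, ← Complex.ofReal_mul, h]
  simp

/-- The subgradient inequality for `w ↦ |w|^p`. -/
lemma norm_rpow_add_re_dual_le {p : ℝ} (hp : 1 < p) (x y : ℂ) :
    ‖x‖ ^ p + p * (dual p x * y).re ≤ ‖x + y‖ ^ p := by
  have hp0 : 0 < p := by linarith
  have hre : (dual p x * (x + y)).re ≤ ‖x‖ ^ (p - 1) * ‖x + y‖ := by
    rw [← norm_dual hp, ← norm_mul]
    exact Complex.re_le_norm _
  have hyoung := Real.young_inequality_of_nonneg (a := ‖x‖ ^ (p - 1)) (b := ‖x + y‖)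
    (by positivity) (norm_nonneg _) (Real.HolderConjugate.conjExponent hp).symm
  rw [← Real.rpow_mul (norm_nonneg _), Real.conjExponent,
    show (p - 1) * (p / (p - 1)) = p by field_simp [show p - 1 ≠ 0 by linarith]] at hyoung
  rw [mul_add, Complex.add_re, dual_mul_self hp, Complex.ofReal_re] at hre
  have h := mul_le_mul_of_nonneg_left (hre.trans hyoung) hp0.le
  have e : p * (‖x‖ ^ p / (p / (p - 1)) + ‖x + y‖ ^ p / p) = (p - 1) * ‖x‖ ^ p + ‖x + y‖ ^ p := by
    field_simp
  linarith

lemma summable_dual_mul {p : ℝ} (hp : 1 < p) {a b : ℕ → ℂ} (ha : Summable fun k => ‖a k‖ ^ p)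
    (hb : Summable fun k => ‖b k‖ ^ p) : Summable fun k => dual p (a k) * b k := by
  refine Summable.of_norm_bounded (g := fun k => ‖a k‖ ^ p + ‖b k‖ ^ p) (ha.add hb) fun k => ?_
  rw [norm_mul, norm_dual hp]
  have h1 : ∀ x : ℝ, 0 ≤ x → x ^ (p - 1) * x = x ^ p := fun x hx => by
    rw [← Real.rpow_add_one' hx (by linarith), sub_add_cancel]
  rcases le_total ‖a k‖ ‖b k‖ with h | h
  · calc ‖a k‖ ^ (p - 1) * ‖b k‖ ≤ ‖b k‖ ^ (p - 1) * ‖b k‖ := by gcongr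
      _ = ‖b k‖ ^ p := h1 _ (norm_nonneg _)
      _ ≤ _ := by linarith [Real.rpow_nonneg (norm_nonneg (a k)) p]
  · calc ‖a k‖ ^ (p - 1) * ‖b k‖ ≤ ‖a k‖ ^ (p - 1) * ‖a k‖ := by gcongr
      _ = ‖a k‖ ^ p := h1 _ (norm_nonneg _)
      _ ≤ _ := by linarith [Real.rpow_nonneg (norm_nonneg (b k)) p]

lemma tsum_norm_rpow_add_re_dual_le {p : ℝ} (hp : 1 < p) {a b : ℕ → ℂ}
    (ha : Summable fun k => ‖a k‖ ^ p) (hb : Summable fun k => ‖b k‖ ^ p) :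
    ∑' k, ‖a k‖ ^ p + p * (∑' k, dual p (a k) * b k).re ≤ ∑' k, ‖a k + b k‖ ^ p := by
  have hs := summable_dual_mul hp ha hb
  have hr : Summable fun k => (dual p (a k) * b k).re := (Complex.hasSum_re hs.hasSum).summable
  rw [Complex.re_tsum hs, ← tsum_mul_left, ← ha.tsum_add (hr.mul_left p)]
  exact (ha.add (hr.mul_left p)).tsum_le_tsum (fun k => norm_rpow_add_re_dual_le hp _ _)
    (summable_add hp.le ha hb)

/-- A minimum of `t ↦ ∑ |a_k + t b_k|^p` at `t = 0` is a critical point. -/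
lemma tsum_dual_mul_eq_zero {p : ℝ} (hp : 1 < p) {a b : ℕ → ℂ}
    (ha : Summable fun k => ‖a k‖ ^ p) (hb : Summable fun k => ‖b k‖ ^ p)
    (hmin : ∀ t : ℂ, ∑' k, ‖a k‖ ^ p ≤ ∑' k, ‖a k + t * b k‖ ^ p) :
    ∑' k, dual p (a k) * b k = 0 := by
  have key : ∀ c : ℂ, 0 ≤ (c * ∑' k, dual p (a k) * b k).re := by
    intro c
    have hcb := summable_const_mul hb c
    -- The subgradient inequality at the displaced point, followed by `t → 0`, avoids
    -- differentiating under the sum.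
    have hpos : ∀ t : ℝ, 0 < t → 0 ≤ (∑' k, dual p (a k + t * (c * b k)) * (c * b k)).re := by
      intro t ht
      have htb := summable_const_mul hcb (t : ℂ)
      have h := tsum_norm_rpow_add_re_dual_le hp (summable_add hp.le ha htb)
        (summable_const_mul hcb (-t : ℂ))
      have e1 : ∀ k, a k + t * (c * b k) + -t * (c * b k) = a k := fun k => by ring
      have e2 : ∀ k, dual p (a k + t * (c * b k)) * (-t * (c * b k)) =
          ((-t : ℝ) : ℂ) * (dual p (a k + t * (c * b k)) * (c * b k)) := fun k => by
        push_cast; ring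
      simp_rw [e1, e2, tsum_mul_left, Complex.re_ofReal_mul] at h
      have h2 := hmin (t * c)
      simp_rw [mul_assoc] at h2
      have h3 : 0 ≤ p * t * (∑' k, dual p (a k + t * (c * b k)) * (c * b k)).re := by linarith
      exact nonneg_of_mul_nonneg_right h3 (by positivity)
    have hsum : Summable fun k => (‖a k‖ + ‖c * b k‖) ^ p := by
      have := summable_add (p := p) hp.le (a := fun k => (‖a k‖ : ℂ))
        (b := fun k => (‖c * b k‖ : ℂ)) (by simpa using ha) (by simpa using hcb)
      refine this.congr fun k => ?_
      rw [← Complex.ofReal_add, Complex.norm_real, Real.norm_of_nonneg (by positivity)]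
    have hlim : Tendsto (fun t : ℝ => ∑' k, dual p (a k + t * (c * b k)) * (c * b k)) (𝓝[>] 0)
        (𝓝 (∑' k, dual p (a k) * (c * b k))) := by
      refine tendsto_tsum_of_dominated_convergence hsum (fun k => ?_) ?_
      · have : Continuous fun t : ℝ => dual p (a k + t * (c * b k)) * (c * b k) :=
          ((continuous_dual hp).comp (by fun_prop)).mul continuous_const
        simpa using (this.tendsto 0).mono_left nhdsWithin_le_nhds
      · filter_upwards [Ioo_mem_nhdsGT (zero_lt_one' ℝ)] with t ht k
        rw [norm_mul, norm_dual hp]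
        have h1 : ‖a k + t * (c * b k)‖ ≤ ‖a k‖ + ‖c * b k‖ := by
          refine (norm_add_le _ _).trans ?_
          gcongr
          rw [norm_mul, Complex.norm_real, Real.norm_of_nonneg ht.1.le]
          exact mul_le_of_le_one_left (norm_nonneg _) ht.2.le
        calc ‖a k + t * (c * b k)‖ ^ (p - 1) * ‖c * b k‖
            ≤ (‖a k‖ + ‖c * b k‖) ^ (p - 1) * (‖a k‖ + ‖c * b k‖) := by
              gcongr
              linarith [norm_nonneg (a k)]
          _ = _ := by rw [← Real.rpow_add_one' (by positivity) (by linarith), sub_add_cancel]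
    have e : ∑' k, dual p (a k) * (c * b k) = c * ∑' k, dual p (a k) * b k := by
      rw [← tsum_mul_left]
      exact tsum_congr fun k => by ring
    rw [e] at hlim
    exact ge_of_tendsto ((Complex.continuous_re.tendsto _).comp hlim)
      (eventually_nhdsWithin_of_forall fun t ht => hpos t ht)
  set S := ∑' k, dual p (a k) * b k
  have h := key (-conj S)
  rw [neg_mul, Complex.conj_mul', Complex.neg_re, ← Complex.ofReal_pow, Complex.ofReal_re] at h
  have : ‖S‖ = 0 := by nlinarith [norm_nonneg S]
  exact norm_eq_zero.1 this

lemma continuous_tsum_norm_add_mul_rpow {p : ℝ} (hp : 1 < p) {a b : ℕ → ℂ}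
    (ha : Summable fun k => ‖a k‖ ^ p) (hb : Summable fun k => ‖b k‖ ^ p) :
    Continuous fun s : ℂ => ∑' k, ‖a k - s * b k‖ ^ p := by
  rw [continuous_iff_continuousAt]
  intro s
  refine ContinuousOn.continuousAt (s := Metric.ball 0 (‖s‖ + 1)) (continuousOn_tsum
    (u := fun k => 2 ^ (p - 1) * (‖a k‖ ^ p + (‖s‖ + 1) ^ p * ‖b k‖ ^ p)) (fun k => ?_)
    ((ha.add (hb.mul_left _)).mul_left _) fun k x hx => ?_)
    (Metric.isOpen_ball.mem_nhds (by simp))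
  · exact (Continuous.rpow_const (by fun_prop) fun _ => Or.inr (by linarith)).continuousOn
  · rw [Real.norm_of_nonneg (by positivity), sub_eq_add_neg]
    refine (rpow_norm_add_le hp.le _ _).trans ?_
    rw [norm_neg, norm_mul, Real.mul_rpow (norm_nonneg _) (norm_nonneg _)]
    have : ‖x‖ ≤ ‖s‖ + 1 := (mem_ball_zero_iff.1 hx).le
    gcongr

/-! ### Best coefficients for the backward shift -/

/-- `s • a` is the best approximation in `ℓ^p` of the backward shift of `a` by multiples of `a`. -/
def IsBestCoeff (p : ℝ) (a : ℕ → ℂ) (s : ℂ) : Prop :=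
  ∀ t : ℂ, ∑' k, ‖a (k + 1) - s * a k‖ ^ p ≤ ∑' k, ‖a (k + 1) - t * a k‖ ^ p

/-- The `ℓ^p` analogue of the numerical range of the backward shift. -/
def shiftRange (p : ℝ) : Set ℂ :=
  {s | ∃ a : ℕ → ℂ, (Summable fun k => ‖a k‖ ^ p) ∧ a 0 ≠ 0 ∧ IsBestCoeff p a s}

lemma summable_succ {p : ℝ} {a : ℕ → ℂ} (ha : Summable fun k => ‖a k‖ ^ p) :
    Summable fun k => ‖a (k + 1)‖ ^ p :=
  (summable_nat_add_iff 1).2 ha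

lemma IsBestCoeff.tsum_dual_eq_zero {p : ℝ} (hp : 1 < p) {a : ℕ → ℂ} {s : ℂ}
    (ha : Summable fun k => ‖a k‖ ^ p) (h : IsBestCoeff p a s) :
    ∑' k, dual p (a (k + 1) - s * a k) * a k = 0 := by
  refine tsum_dual_mul_eq_zero hp (summable_sub_mul hp.le (summable_succ ha) ha s) ha fun t => ?_
  refine (h (s - t)).trans_eq (tsum_congr fun k => ?_)
  congr 2
  ring

/-- The best coefficient lies in the half plane to which the gradient at `s` points. -/
lemma IsBestCoeff.re_mul_tsum_nonneg {p : ℝ} (hp : 1 < p) {a : ℕ → ℂ} {s t : ℂ}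
    (ha : Summable fun k => ‖a k‖ ^ p) (h : IsBestCoeff p a t) :
    0 ≤ ((t - s) * ∑' k, dual p (a (k + 1) - s * a k) * a k).re := by
  have h1 := tsum_norm_rpow_add_re_dual_le hp (summable_sub_mul hp.le (summable_succ ha) ha s)
    (summable_const_mul ha (s - t))
  have e1 : ∀ k, a (k + 1) - s * a k + (s - t) * a k = a (k + 1) - t * a k := fun k => by ring
  have e2 : ∀ k, dual p (a (k + 1) - s * a k) * ((s - t) * a k) =
    (s - t) * (dual p (a (k + 1) - s * a k) * a k) := fun k => by ring
  simp_rw [e1, e2, tsum_mul_left] at h1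
  have h2 := h s
  have h3 : (s - t) * ∑' k, dual p (a (k + 1) - s * a k) * a k =
    -((t - s) * ∑' k, dual p (a (k + 1) - s * a k) * a k) := by ring
  rw [h3, Complex.neg_re] at h1
  have h4 : 0 ≤ p * ((t - s) * ∑' k, dual p (a (k + 1) - s * a k) * a k).re := by linarith
  exact nonneg_of_mul_nonneg_right h4 (by linarith)

/-- The term `k = 0` alone makes the continuous objective coercive in `s`, since `a 0 ≠ 0`. -/
lemma exists_isBestCoeff {p : ℝ} (hp : 1 < p) {a : ℕ → ℂ} (ha : Summable fun k => ‖a k‖ ^ p)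
    (ha0 : a 0 ≠ 0) : ∃ s, IsBestCoeff p a s := by
  refine (continuous_tsum_norm_add_mul_rpow hp (summable_succ ha) ha).exists_forall_le ?_
  have h1 : Tendsto (fun s : ℂ => (‖s‖ * ‖a 0‖ - ‖a 1‖) ^ p) (cocompact ℂ) atTop := by
    refine (tendsto_rpow_atTop (by linarith)).comp ?_
    exact tendsto_atTop_add_const_right _ _
      (tendsto_norm_cocompact_atTop.atTop_mul_const (norm_pos_iff.2 ha0))
  refine tendsto_atTop_mono' _ ?_ h1
  have h2 : Tendsto (fun s : ℂ => ‖s‖ * ‖a 0‖ - ‖a 1‖) (cocompact ℂ) atTop :=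
    tendsto_atTop_add_const_right _ _
      (tendsto_norm_cocompact_atTop.atTop_mul_const (norm_pos_iff.2 ha0))
  filter_upwards [h2.eventually_ge_atTop 0] with s hs
  calc (‖s‖ * ‖a 0‖ - ‖a 1‖) ^ p ≤ ‖a (0 + 1) - s * a 0‖ ^ p := by
        refine Real.rpow_le_rpow hs ?_ (by linarith)
        rw [← norm_mul, norm_sub_rev]
        exact norm_sub_norm_le _ _
    _ ≤ _ := (summable_sub_mul hp.le (summable_succ ha) ha s).le_tsum 0
        fun k _ => by positivity

/-! ### Upper bound for the radius -/

/-- A Clarkson type inequality. -/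
lemma rpow_norm_add_add_rpow_norm_sub_le {p : ℝ} (hp : 1 < p) (x y : ℂ) :
    ‖x + y‖ ^ p + ‖x - y‖ ^ p ≤ max 2 (2 ^ (p - 1)) * (‖x‖ ^ p + ‖y‖ ^ p) := by
  -- In terms of squared norms, the parallelogram law reduces the claim to concavity (`p ≤ 2`) or
  -- convexity (`p ≥ 2`) of `t ↦ t ^ (p / 2)` together with its sub- or superadditivity.
  have hsq : ∀ w : ℂ, ‖w‖ ^ p = (‖w‖ ^ 2) ^ (p / 2) := fun w => by
    rw [← Real.rpow_natCast, ← Real.rpow_mul (norm_nonneg _)]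
    congr 1
    push_cast
    ring
  have hpar := parallelogram_law_with_norm ℝ x y
  have hx : 0 ≤ ‖x‖ ^ 2 := by positivity
  have hy : 0 ≤ ‖y‖ ^ 2 := by positivity
  have hs : 0 ≤ ‖x + y‖ ^ 2 := by positivity
  have hd : 0 ≤ ‖x - y‖ ^ 2 := by positivity
  simp only [hsq]
  generalize ‖x‖ ^ 2 = X at *
  generalize ‖y‖ ^ 2 = Y at *
  generalize ‖x + y‖ ^ 2 = S at *
  generalize ‖x - y‖ ^ 2 = D at *
  rcases le_total p 2 with h | h
  · have hconc := (Real.concaveOn_rpow (p := p / 2) (by linarith) (by linarith)).2 hs hd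
      (by norm_num : (0 : ℝ) ≤ 1 / 2) (by norm_num : (0 : ℝ) ≤ 1 / 2) (by norm_num)
    simp only [smul_eq_mul] at hconc
    rw [show 1 / 2 * S + 1 / 2 * D = X + Y by linarith] at hconc
    have hadd := Real.rpow_add_le_add_rpow hx hy (by linarith : 0 ≤ p / 2) (by linarith)
    calc S ^ (p / 2) + D ^ (p / 2) ≤ 2 * (X ^ (p / 2) + Y ^ (p / 2)) := by linarith
      _ ≤ _ := by gcongr; exact le_max_left _ _
  · have hconv := (convexOn_rpow (p := p / 2) (by linarith)).2 hx hy
      (by norm_num : (0 : ℝ) ≤ 1 / 2) (by norm_num : (0 : ℝ) ≤ 1 / 2) (by norm_num)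
    simp only [smul_eq_mul] at hconv
    have hadd := Real.add_rpow_le_rpow_add hs hd (by linarith : 1 ≤ p / 2)
    have e : (S + D) ^ (p / 2) = 2 ^ p * (1 / 2 * X + 1 / 2 * Y) ^ (p / 2) := by
      rw [hpar, show (2 : ℝ) ^ p = (2 ^ (2 : ℝ)) ^ (p / 2) by
        rw [← Real.rpow_mul (by norm_num)]; congr 1; ring,
        ← Real.mul_rpow (by positivity) (by positivity)]
      congr 1
      norm_num
      ring
    have e2 : (2 : ℝ) ^ p = 2 ^ (p - 1) * 2 := by
      rw [← Real.rpow_add_one (by norm_num), sub_add_cancel]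
    calc S ^ (p / 2) + D ^ (p / 2) ≤ 2 ^ p * (1 / 2 * X + 1 / 2 * Y) ^ (p / 2) := by linarith
      _ ≤ 2 ^ p * (1 / 2 * X ^ (p / 2) + 1 / 2 * Y ^ (p / 2)) := by gcongr
      _ = 2 ^ (p - 1) * (X ^ (p / 2) + Y ^ (p / 2)) := by rw [e2]; ring
      _ ≤ _ := by gcongr; exact le_max_right _ _

/-- Apply Clarkson to `S a` and `S a - s a`: their difference is `s a`, their sum `2 (S a - (s / 2)
a)`. Optimality of `s` against `s / 2`, with the constant at most `2 ^ p`, cancels the residual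
terms; then use that `S` is a contraction. -/
lemma norm_rpow_le_of_isBestCoeff {p : ℝ} (hp : 1 < p) {a : ℕ → ℂ} {s : ℂ}
    (ha : Summable fun k => ‖a k‖ ^ p) (ha0 : a 0 ≠ 0) (h : IsBestCoeff p a s) :
    ‖s‖ ^ p ≤ max 2 (2 ^ (p - 1)) := by
  have hp1 := hp.le
  have ha1 := summable_succ ha
  have hP : 0 < ∑' k, ‖a k‖ ^ p :=
    (Real.rpow_pos_of_pos (norm_pos_iff.2 ha0) p).trans_le (ha.le_tsum 0 fun k _ => by positivity)
  have hU : ∑' k, ‖a (k + 1)‖ ^ p ≤ ∑' k, ‖a k‖ ^ p := by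
    rw [ha.tsum_eq_zero_add]
    linarith [Real.rpow_nonneg (norm_nonneg (a 0)) p]
  have hV := summable_sub_mul hp1 ha1 ha s
  have hW := summable_sub_mul hp1 ha1 ha (s / 2)
  have hclark : ‖s‖ ^ p * ∑' k, ‖a k‖ ^ p + 2 ^ p * ∑' k, ‖a (k + 1) - s / 2 * a k‖ ^ p ≤
      max 2 (2 ^ (p - 1)) *
        (∑' k, ‖a (k + 1)‖ ^ p + ∑' k, ‖a (k + 1) - s * a k‖ ^ p) := by
    rw [← tsum_mul_left, ← tsum_mul_left, ← ha1.tsum_add hV, ← tsum_mul_left,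
      ← (ha.mul_left _).tsum_add (hW.mul_left _)]
    refine ((ha.mul_left _).add (hW.mul_left _)).tsum_le_tsum (fun k => ?_)
      ((ha1.add hV).mul_left _)
    have h1 := rpow_norm_add_add_rpow_norm_sub_le hp (a (k + 1)) (a (k + 1) - s * a k)
    rw [show a (k + 1) + (a (k + 1) - s * a k) = 2 * (a (k + 1) - s / 2 * a k) by ring,
      show a (k + 1) - (a (k + 1) - s * a k) = s * a k by ring, norm_mul, norm_mul,
      Real.mul_rpow (norm_nonneg _) (norm_nonneg _), Real.mul_rpow (norm_nonneg _) (norm_nonneg _),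
      Complex.norm_ofNat] at h1
    linarith
  have hC : max 2 ((2 : ℝ) ^ (p - 1)) ≤ 2 ^ p :=
    max_le (by simpa using Real.rpow_le_rpow_of_exponent_le (one_le_two (α := ℝ)) hp1)
      (Real.rpow_le_rpow_of_exponent_le one_le_two (by linarith))
  have hV0 : 0 ≤ ∑' k, ‖a (k + 1) - s * a k‖ ^ p := tsum_nonneg fun k => by positivity
  have h2 := mul_le_mul_of_nonneg_left (h (s / 2)) (by positivity : (0 : ℝ) ≤ 2 ^ p)
  have h3 := mul_le_mul_of_nonneg_right hC hV0
  have h4 := mul_le_mul_of_nonneg_left hU (by positivity : 0 ≤ max 2 ((2 : ℝ) ^ (p - 1)))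
  exact le_of_mul_le_mul_right (by linarith) hP

/-- A bound for `shiftRange p`. -/
noncomputable def rangeBound (p : ℝ) : ℝ := max 2 (2 ^ (p - 1)) ^ p⁻¹

lemma rangeBound_lt_two {p : ℝ} (hp : 1 < p) : rangeBound p < 2 := by
  rw [rangeBound, Real.rpow_inv_lt_iff_of_pos (by positivity) (by norm_num) (by linarith)]
  refine max_lt ?_ (Real.rpow_lt_rpow_of_exponent_lt one_lt_two (by linarith))
  simpa using Real.rpow_lt_rpow_of_exponent_lt (one_lt_two (α := ℝ)) hp

lemma norm_le_of_isBestCoeff {p : ℝ} (hp : 1 < p) {a : ℕ → ℂ} {s : ℂ}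
    (ha : Summable fun k => ‖a k‖ ^ p) (ha0 : a 0 ≠ 0) (h : IsBestCoeff p a s) :
    ‖s‖ ≤ rangeBound p :=
  (Real.le_rpow_inv_iff_of_pos (norm_nonneg _) (by positivity) (by linarith)).2
    (norm_rpow_le_of_isBestCoeff hp ha ha0 h)

lemma norm_le_of_mem_shiftRange {p : ℝ} (hp : 1 < p) {s : ℂ} (hs : s ∈ shiftRange p) :
    ‖s‖ ≤ rangeBound p := by
  obtain ⟨a, ha, ha0, h⟩ := hs
  exact norm_le_of_isBestCoeff hp ha ha0 h

/-! ### Shape of the range: rotations, outward moves, filling -/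

lemma mul_mem_shiftRange {p : ℝ} {s u : ℂ} (hu : ‖u‖ = 1) (hs : s ∈ shiftRange p) :
    u * s ∈ shiftRange p := by
  obtain ⟨a, ha, ha0, h⟩ := hs
  have hu0 : u ≠ 0 := norm_ne_zero_iff.1 (by simp [hu])
  refine ⟨fun k => u ^ k * a k, by simpa [hu] using ha, by simpa using ha0, fun t => ?_⟩
  have e : ∀ (t : ℂ) (k : ℕ), ‖u ^ (k + 1) * a (k + 1) - t * (u ^ k * a k)‖ =
      ‖a (k + 1) - t / u * a k‖ := fun t k => by
    rw [show u ^ (k + 1) * a (k + 1) - t * (u ^ k * a k) =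
      u ^ (k + 1) * (a (k + 1) - t / u * a k) by field_simp; ring, norm_mul, norm_pow, hu, one_pow,
      one_mul]
  simp only [e, mul_div_cancel_left₀ s hu0]
  exact h _

lemma mem_shiftRange_of_norm_eq {p : ℝ} {s t : ℂ} (hs : s ∈ shiftRange p) (h : ‖t‖ = ‖s‖) :
    t ∈ shiftRange p := by
  rcases eq_or_ne s 0 with rfl | hs0
  · rw [norm_zero, norm_eq_zero] at h
    rwa [h]
  · rw [← div_mul_cancel₀ t hs0]
    exact mul_mem_shiftRange (by rw [norm_div, h, div_self (norm_ne_zero_iff.2 hs0)]) hs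

/-- Prepending a suitable coefficient moves the best coefficient outwards. -/
lemma exists_norm_lt_mem_shiftRange {p : ℝ} (hp : 1 < p) {s : ℂ} (hs : s ∈ shiftRange p)
    (hs0 : s ≠ 0) : ∃ t ∈ shiftRange p, ‖s‖ < ‖t‖ := by
  obtain ⟨a, ha, ha0, h⟩ := hs
  -- The first residual `b 1 - s * b 0` is then `a 0 / 2`; the later ones contribute nothing to the
  -- gradient because `s` was optimal for `a`.
  let b : ℕ → ℂ := fun k => Nat.casesOn k (a 0 / (2 * s)) a
  have hb0 : b 0 ≠ 0 := div_ne_zero ha0 (by simpa using hs0)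
  have hb : Summable fun k => ‖b k‖ ^ p := (summable_nat_add_iff 1).1 ha
  obtain ⟨t, ht⟩ := exists_isBestCoeff hp hb hb0
  refine ⟨t, ⟨b, hb, hb0, ht⟩, ?_⟩
  have hF : ∑' k, dual p (b (k + 1) - s * b k) * b k = s⁻¹ * ((‖a 0 / 2‖ ^ p : ℝ) : ℂ) := by
    rw [(summable_dual_mul hp (summable_sub_mul hp.le (summable_succ hb) hb s) hb).tsum_eq_zero_add]
    change dual p (a 0 - s * (a 0 / (2 * s))) * (a 0 / (2 * s)) +
      ∑' k, dual p (a (k + 1) - s * a k) * a k = _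
    rw [h.tsum_dual_eq_zero hp ha, add_zero, ← dual_mul_self hp,
      show a 0 - s * (a 0 / (2 * s)) = a 0 / 2 by field_simp; ring]
    field_simp
  have hr : 0 < ‖a 0 / 2‖ ^ p := Real.rpow_pos_of_pos (norm_pos_iff.2 (by simpa using ha0)) p
  have hne : t ≠ s := by
    rintro rfl
    rw [ht.tsum_dual_eq_zero hp hb] at hF
    have : (‖a 0 / 2‖ ^ p : ℝ) = 0 := by simpa [hs0] using hF.symm
    exact hr.ne' this
  have hre := ht.re_mul_tsum_nonneg hp hb (s := s)
  rw [hF, ← mul_assoc, Complex.re_mul_ofReal] at hre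
  -- The gradient at `s` is a positive multiple of `s⁻¹`, so the half plane containing `t` is `Re (t
  -- / s) ≥ 1`, which meets the closed unit disc only at `t = s`.
  have h1 : 1 ≤ (t / s).re := by
    have := nonneg_of_mul_nonneg_left hre hr
    rw [← div_eq_mul_inv, sub_div, div_self hs0] at this
    simpa using this
  have h2 : 1 < ‖t / s‖ := by
    refine lt_of_le_of_ne (h1.trans (Complex.re_le_norm _)) fun h3 => hne ?_
    have h4 : (t / s).re = ‖t / s‖ := le_antisymm (Complex.re_le_norm _) (h3 ▸ h1)
    have h5 := Complex.re_eq_norm.1 h4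
    have h6 : t / s = 1 := by
      apply Complex.ext
      · rw [h4, ← h3]; rfl
      · exact (Complex.nonneg_iff.1 h5).2.symm
    exact (div_eq_one_iff_eq hs0).1 h6
  rwa [norm_div, one_lt_div (norm_pos_iff.2 hs0)] at h2

lemma convexOn_norm_rpow {p : ℝ} (hp : 1 ≤ p) : ConvexOn ℝ Set.univ fun w : ℂ => ‖w‖ ^ p := by
  refine ⟨convex_univ, fun x _ y _ α β hα hβ hαβ => ?_⟩
  refine le_trans ?_ ((convexOn_rpow hp).2 (norm_nonneg x) (norm_nonneg y) hα hβ hαβ)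
  refine Real.rpow_le_rpow (norm_nonneg _) ((norm_add_le _ _).trans_eq ?_) (by linarith)
  simp [abs_of_nonneg hα, abs_of_nonneg hβ]

/-- Convexity of the set of minimizers serves in place of uniqueness in the connectedness argument
below. -/
lemma convex_setOf_isBestCoeff {p : ℝ} (hp : 1 ≤ p) {a : ℕ → ℂ}
    (ha : Summable fun k => ‖a k‖ ^ p) : Convex ℝ {s | IsBestCoeff p a s} := by
  intro x hx y hy α β hα hβ hαβ t
  have hs := summable_sub_mul hp (summable_succ ha) ha
  calc ∑' k, ‖a (k + 1) - (α • x + β • y) * a k‖ ^ p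
      ≤ ∑' k, (α * ‖a (k + 1) - x * a k‖ ^ p + β * ‖a (k + 1) - y * a k‖ ^ p) := by
        refine (hs _).tsum_le_tsum (fun k => ?_) (((hs x).mul_left α).add ((hs y).mul_left β))
        have h := (convexOn_norm_rpow hp).2 (Set.mem_univ (a (k + 1) - x * a k))
          (Set.mem_univ (a (k + 1) - y * a k)) hα hβ hαβ
        refine le_of_eq_of_le ?_ h
        have hαβ' : (α : ℂ) + β = 1 := by exact_mod_cast hαβ
        simp only [Complex.real_smul]
        congr 2
        linear_combination (-a (k + 1)) * hαβ'
    _ = α * ∑' k, ‖a (k + 1) - x * a k‖ ^ p + β * ∑' k, ‖a (k + 1) - y * a k‖ ^ p := by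
        rw [((hs x).mul_left α).tsum_add ((hs y).mul_left β), tsum_mul_left, tsum_mul_left]
    _ ≤ α * ∑' k, ‖a (k + 1) - t * a k‖ ^ p + β * ∑' k, ‖a (k + 1) - t * a k‖ ^ p :=
        add_le_add (mul_le_mul_of_nonneg_left (hx t) hα) (mul_le_mul_of_nonneg_left (hy t) hβ)
    _ = _ := by rw [← add_mul, hαβ, one_mul]

/-- Multiply all coefficients but the first one by `r`. -/
def scaleTail (a : ℕ → ℂ) (r : ℝ) (k : ℕ) : ℂ := Nat.casesOn k (a 0) fun j => r * a (j + 1)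

lemma summable_scaleTail {p : ℝ} {a : ℕ → ℂ} (ha : Summable fun k => ‖a k‖ ^ p) (r : ℝ) :
    Summable fun k => ‖scaleTail a r k‖ ^ p :=
  (summable_nat_add_iff 1).1 (summable_const_mul (summable_succ ha) (r : ℂ))

lemma scaleTail_one (a : ℕ → ℂ) : scaleTail a 1 = a := by
  funext k
  cases k <;> simp [scaleTail]

lemma tsum_scaleTail {p : ℝ} (hp : 1 < p) {a : ℕ → ℂ} (ha : Summable fun k => ‖a k‖ ^ p) (r : ℝ)
    (s : ℂ) : ∑' k, ‖scaleTail a r (k + 1) - s * scaleTail a r k‖ ^ p =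
      ‖r * a 1 - s * a 0‖ ^ p + |r| ^ p * ∑' k, ‖a (k + 1 + 1) - s * a (k + 1)‖ ^ p := by
  have hb := summable_scaleTail ha r
  rw [(summable_sub_mul hp.le (summable_succ hb) hb s).tsum_eq_zero_add, ← tsum_mul_left]
  refine congrArg₂ _ rfl (tsum_congr fun k => ?_)
  change ‖r * a (k + 1 + 1) - s * (r * a (k + 1))‖ ^ p = _
  rw [show r * a (k + 1 + 1) - s * (r * a (k + 1)) = r * (a (k + 1 + 1) - s * a (k + 1)) by ring,
    norm_mul, Complex.norm_real, Real.mul_rpow (norm_nonneg _) (norm_nonneg _), Real.norm_eq_abs]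

lemma continuous_tsum_scaleTail {p : ℝ} (hp : 1 < p) {a : ℕ → ℂ}
    (ha : Summable fun k => ‖a k‖ ^ p) :
    Continuous fun x : ℝ × ℂ =>
      ∑' k, ‖scaleTail a x.1 (k + 1) - x.2 * scaleTail a x.1 k‖ ^ p := by
  simp_rw [tsum_scaleTail hp ha]
  have ha1 := summable_succ ha
  refine Continuous.add (Continuous.rpow_const (by fun_prop) fun _ => Or.inr (by linarith))
    (Continuous.mul (Continuous.rpow_const (by fun_prop) fun _ => Or.inr (by linarith)) ?_)
  exact (continuous_tsum_norm_add_mul_rpow hp (summable_succ ha1) ha1).comp continuous_snd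

/-- Optimality is a closed condition on `(r, s)`, and projecting along the compact `C` keeps it
closed. -/
lemma isClosed_setOf_exists_isBestCoeff_scaleTail {p : ℝ} (hp : 1 < p) {a : ℕ → ℂ}
    (ha : Summable fun k => ‖a k‖ ^ p) {C : Set ℂ} (hC : IsCompact C) :
    IsClosed {r : ℝ | r ∈ Set.Icc (0 : ℝ) 1 ∧ ∃ s ∈ C, IsBestCoeff p (scaleTail a r) s} := by
  have hclosed : IsClosed {x : ℝ × ℂ | IsBestCoeff p (scaleTail a x.1) x.2} := by
    simp only [IsBestCoeff, Set.ofPred_forall]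
    have hcont := continuous_tsum_scaleTail hp ha
    exact isClosed_iInter fun t => isClosed_le hcont
      (hcont.comp (by fun_prop : Continuous fun x : ℝ × ℂ => (x.1, t)))
  have hcomp := (((isCompact_Icc (a := (0 : ℝ)) (b := 1)).prod hC).inter_right hclosed).image
    continuous_fst
  convert hcomp.isClosed using 1
  ext r
  constructor
  · rintro ⟨hr, s, hs, h⟩
    exact ⟨(r, s), ⟨⟨hr, hs⟩, h⟩, rfl⟩
  · rintro ⟨⟨r, s⟩, ⟨⟨hr, hs⟩, h⟩, rfl⟩
    exact ⟨hr, s, hs, h⟩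

/-- Scaling the tail by `r` deforms the best coefficient from 0 to `s`. Closed sets `A` and `B`
cover `[0, 1]`, so some `r` has minimizers on both sides of the circle of radius `‖t‖`; the segment
joining them consists of minimizers and crosses it. -/
lemma mem_shiftRange_of_norm_le {p : ℝ} (hp : 1 < p) {s t : ℂ} (hs : s ∈ shiftRange p)
    (hts : ‖t‖ ≤ ‖s‖) : t ∈ shiftRange p := by
  obtain ⟨a, ha, ha0, h⟩ := hs
  have hsum := summable_scaleTail ha
  have ha0' : ∀ r, scaleTail a r 0 ≠ 0 := fun _ => ha0
  let A := {r : ℝ | r ∈ Set.Icc (0 : ℝ) 1 ∧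
    ∃ s ∈ Metric.closedBall (0 : ℂ) ‖t‖, IsBestCoeff p (scaleTail a r) s}
  let B := {r : ℝ | r ∈ Set.Icc (0 : ℝ) 1 ∧
    ∃ s ∈ Metric.closedBall (0 : ℂ) (rangeBound p) ∩ {s | ‖t‖ ≤ ‖s‖},
      IsBestCoeff p (scaleTail a r) s}
  have hA : IsClosed A :=
    isClosed_setOf_exists_isBestCoeff_scaleTail hp ha (isCompact_closedBall _ _)
  have hB : IsClosed B := isClosed_setOf_exists_isBestCoeff_scaleTail hp ha
    ((isCompact_closedBall _ _).inter_right (isClosed_le continuous_const continuous_norm))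
  have hcover : Set.Icc (0 : ℝ) 1 ⊆ A ∪ B := by
    intro r hr
    obtain ⟨s, hs⟩ := exists_isBestCoeff hp (hsum r) (ha0' r)
    rcases le_total ‖s‖ ‖t‖ with hst | hst
    · exact Or.inl ⟨hr, s, by simpa using hst, hs⟩
    · exact Or.inr ⟨hr, s, ⟨by simpa using norm_le_of_isBestCoeff hp (hsum r) (ha0' r) hs, hst⟩, hs⟩
  have h0 : (0 : ℝ) ∈ A := by
    refine ⟨by simp, 0, by simp, fun s => ?_⟩
    rw [tsum_scaleTail hp ha, tsum_scaleTail hp ha]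
    simp only [Complex.ofReal_zero, zero_mul, sub_zero, norm_zero, abs_zero,
      Real.zero_rpow (by linarith : p ≠ 0), add_zero]
    positivity
  have h1 : (1 : ℝ) ∈ B := by
    refine ⟨by simp, s, ⟨by simpa using norm_le_of_isBestCoeff hp ha ha0 h, hts⟩, ?_⟩
    rwa [scaleTail_one]
  obtain ⟨r, -, ⟨-, x, hx, hxb⟩, -, y, ⟨-, hy⟩, hyb⟩ :=
    isPreconnected_closed_iff.1 isPreconnected_Icc A B hA hB hcover ⟨0, by simp, h0⟩
      ⟨1, by simp, h1⟩
  have hx' : ‖x‖ ≤ ‖t‖ := by simpa using hx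
  obtain ⟨u, hu, hut⟩ := (convex_segment x y).isPreconnected.intermediate_value
    (left_mem_segment ℝ x y) (right_mem_segment ℝ x y) continuous_norm.continuousOn
    (show ‖t‖ ∈ Set.Icc ‖x‖ ‖y‖ from ⟨hx', hy⟩)
  have hub := (convex_setOf_isBestCoeff hp.le (hsum r)).segment_subset hxb hyb hu
  exact mem_shiftRange_of_norm_eq ⟨_, hsum r, ha0' r, hub⟩ hut.symm

/-! ### Lower bound for the radius when `p ≠ 2` -/

/-- The sum is the gradient pairing at `s = 1`; when it is positive, the best coefficient has real
part at least 1. -/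
lemma exists_one_le_norm_of_sum_pos {p : ℝ} (hp : 1 < p) {x : ℕ → ℝ} {N : ℕ} (hx0 : x 0 ≠ 0)
    (hx : ∀ k, N ≤ k → x k = 0)
    (hpos : 0 < ∑ k ∈ Finset.range N, |x (k + 1) - x k| ^ (p - 2) * (x (k + 1) - x k) * x k) :
    ∃ s ∈ shiftRange p, 1 ≤ ‖s‖ := by
  have ha : Summable fun k => ‖((x k : ℝ) : ℂ)‖ ^ p := by
    refine summable_of_ne_finset_zero (s := Finset.range N) fun k hk => ?_
    rw [hx k (by simpa using hk)]
    simp [Real.zero_rpow (by linarith : p ≠ 0)]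
  obtain ⟨s, hs⟩ := exists_isBestCoeff hp ha (by simpa using hx0)
  refine ⟨s, ⟨_, ha, by simpa using hx0, hs⟩, ?_⟩
  have h := hs.re_mul_tsum_nonneg hp ha (s := 1)
  have e : ∑' k, dual p ((x (k + 1) : ℂ) - 1 * x k) * x k =
      ((∑ k ∈ Finset.range N, |x (k + 1) - x k| ^ (p - 2) * (x (k + 1) - x k) * x k : ℝ) : ℂ) := by
    rw [tsum_eq_sum (s := Finset.range N) fun k hk => by
      rw [hx k (by simpa using hk)]; simp, Complex.ofReal_sum]
    refine Finset.sum_congr rfl fun k _ => ?_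
    rw [one_mul, ← Complex.ofReal_sub, dual_ofReal, ← Complex.ofReal_mul]
  rw [e, Complex.re_mul_ofReal] at h
  have h1 := nonneg_of_mul_nonneg_left h hpos
  rw [Complex.sub_re, Complex.one_re] at h1
  linarith [Complex.re_le_norm s]

lemma exists_one_le_norm_mem_shiftRange_of_lt_two {p : ℝ} (hp : 1 < p) (hp2 : p < 2) :
    ∃ s ∈ shiftRange p, 1 ≤ ‖s‖ := by
  have hlim : Tendsto (fun n : ℕ => (n : ℝ) ^ (2 - p)) atTop atTop :=
    (tendsto_rpow_atTop (by linarith)).comp tendsto_natCast_atTop_atTop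
  obtain ⟨n, hn, hn0⟩ := ((hlim.eventually_gt_atTop ((2 : ℝ) ^ p)).and
    (eventually_gt_atTop 0)).exists
  have hn' : (0 : ℝ) < n := by exact_mod_cast hn0
  -- Slow climb from 1 to 2, then a drop to 0: the climb earns at least `n ^ (2 - p)`, which is
  -- unbounded, while the drop costs `2 ^ p`.
  let x : ℕ → ℝ := fun k => if k ≤ n then 1 + k / n else 0
  refine exists_one_le_norm_of_sum_pos hp (x := x) (N := n + 1) (by simp [x])
    (fun k hk => if_neg (by omega)) ?_
  have hlast : |x (n + 1) - x n| ^ (p - 2) * (x (n + 1) - x n) * x n = -2 ^ p := by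
    have h1 : x (n + 1) = 0 := if_neg (by omega)
    have h2 : x n = 2 := by simp only [x, le_refl, if_true]; field_simp; norm_num
    rw [h1, h2, zero_sub, abs_neg, abs_two, show p = p - 2 + 1 + 1 by ring,
      Real.rpow_add_one two_ne_zero, Real.rpow_add_one two_ne_zero]
    ring_nf
  have hstep : ∀ k ∈ Finset.range n, (n : ℝ) ^ (2 - p) * (n : ℝ)⁻¹ ≤
      |x (k + 1) - x k| ^ (p - 2) * (x (k + 1) - x k) * x k := by
    intro k hk
    have hk := Finset.mem_range.1 hk
    have h1 : x (k + 1) - x k = (n : ℝ)⁻¹ := by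
      simp only [x, if_pos (show k + 1 ≤ n by omega), if_pos hk.le]
      push_cast
      field_simp
      ring
    have h2 : 1 ≤ x k := by
      simp only [x, if_pos hk.le]
      have : (0 : ℝ) ≤ k / n := by positivity
      linarith
    rw [h1, abs_of_pos (by positivity), Real.inv_rpow hn'.le, ← Real.rpow_neg hn'.le, neg_sub]
    exact le_mul_of_one_le_right (by positivity) h2
  have hsum := Finset.card_nsmul_le_sum _ _ _ hstep
  rw [Finset.card_range, nsmul_eq_mul, show (n : ℝ) * ((n : ℝ) ^ (2 - p) * (n : ℝ)⁻¹) =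
    (n : ℝ) ^ (2 - p) by field_simp] at hsum
  rw [Finset.sum_range_succ, hlast]
  linarith

lemma exists_one_le_norm_mem_shiftRange_of_two_lt {p : ℝ} (hp2 : 2 < p) :
    ∃ s ∈ shiftRange p, 1 ≤ ‖s‖ := by
  have hlim : Tendsto (fun n : ℕ => (2 / (n : ℝ)) ^ (p - 2)) atTop (𝓝 0) := by
    have h := (tendsto_const_div_atTop_nhds_zero_nat (2 : ℝ)).rpow_const
      (p := p - 2) (Or.inr (by linarith))
    rwa [Real.zero_rpow (by linarith)] at h
  obtain ⟨n, hn, hn0⟩ := ((hlim.eventually_lt_const (show (0 : ℝ) < 1 / 4 by norm_num)).and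
    (eventually_gt_atTop 0)).exists
  have hn' : (0 : ℝ) < n := by exact_mod_cast hn0
  -- The opposite profile: a jump from 1 to 2 earns 1, and the slow descent to 0 costs at most `4 *
  -- (2 / n) ^ (p - 2)`, which tends to 0.
  let y : ℕ → ℝ := fun k => if k ≤ n then 2 - 2 * k / n else 0
  let x : ℕ → ℝ := fun k => Nat.casesOn k 1 y
  refine exists_one_le_norm_of_sum_pos (by linarith) (x := x) (N := n + 1) one_ne_zero
    (fun k hk => ?_) ?_
  · obtain ⟨j, rfl⟩ : ∃ j, k = j + 1 := ⟨k - 1, by omega⟩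
    change y j = 0
    simp only [y]
    split_ifs with h
    · obtain rfl : j = n := by omega
      field_simp
      ring
    · rfl
  have hfirst : |x (0 + 1) - x 0| ^ (p - 2) * (x (0 + 1) - x 0) * x 0 = 1 := by
    change |y 0 - 1| ^ (p - 2) * (y 0 - 1) * 1 = 1
    norm_num [y]
  have hstep : ∀ k ∈ Finset.range n, -((2 / (n : ℝ)) ^ (p - 2) * (4 / n)) ≤
      |x (k + 1 + 1) - x (k + 1)| ^ (p - 2) * (x (k + 1 + 1) - x (k + 1)) * x (k + 1) := by
    intro k hk
    have hk := Finset.mem_range.1 hk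
    change _ ≤ |y (k + 1) - y k| ^ (p - 2) * (y (k + 1) - y k) * y k
    have h1 : y (k + 1) - y k = -(2 / n) := by
      simp only [y, if_pos (show k + 1 ≤ n by omega), if_pos hk.le]
      push_cast
      field_simp
      ring
    have h2 : y k ≤ 2 := by
      simp only [y, if_pos hk.le]
      have : (0 : ℝ) ≤ 2 * k / n := by positivity
      linarith
    rw [h1, abs_neg, abs_of_pos (by positivity)]
    have h3 := mul_le_mul_of_nonneg_left h2
      (by positivity : 0 ≤ (2 / (n : ℝ)) ^ (p - 2) * (2 / n))
    calc -((2 / (n : ℝ)) ^ (p - 2) * (4 / n)) = -((2 / (n : ℝ)) ^ (p - 2) * (2 / n) * 2) := by ring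
      _ ≤ -((2 / (n : ℝ)) ^ (p - 2) * (2 / n) * y k) := neg_le_neg h3
      _ = _ := by ring
  have hsum := Finset.card_nsmul_le_sum _ _ _ hstep
  rw [Finset.card_range, nsmul_eq_mul, show (n : ℝ) * -((2 / (n : ℝ)) ^ (p - 2) * (4 / n)) =
    -(4 * (2 / (n : ℝ)) ^ (p - 2)) by field_simp] at hsum
  rw [Finset.sum_range_succ', hfirst]
  linarith

lemma exists_one_lt_norm_mem_shiftRange {p : ℝ} (hp : 1 < p) (hp2 : p ≠ 2) :
    ∃ s ∈ shiftRange p, 1 < ‖s‖ := by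
  obtain ⟨s, hs, h⟩ : ∃ s ∈ shiftRange p, 1 ≤ ‖s‖ := by
    rcases hp2.lt_or_gt with h | h
    · exact exists_one_le_norm_mem_shiftRange_of_lt_two hp h
    · exact exists_one_le_norm_mem_shiftRange_of_two_lt h
  obtain ⟨t, ht, hst⟩ := exists_norm_lt_mem_shiftRange hp hs
    (norm_pos_iff.1 (zero_lt_one.trans_le h))
  exact ⟨t, ht, h.trans_lt hst⟩

/-- Apart from the origin, `shiftRange p` is an open disk. -/
lemma exists_mem_shiftRange_iff_norm_lt {p : ℝ} (hp : 1 < p) (hp2 : p ≠ 2) :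
    ∃ τ : ℝ, 1 < τ ∧ τ < 2 ∧ ∀ s : ℂ, s ≠ 0 → (s ∈ shiftRange p ↔ ‖s‖ < τ) := by
  obtain ⟨s, hs, hs1⟩ := exists_one_lt_norm_mem_shiftRange hp hp2
  have hbdd : BddAbove (norm '' shiftRange p) :=
    ⟨rangeBound p, by rintro _ ⟨t, ht, rfl⟩; exact norm_le_of_mem_shiftRange hp ht⟩
  have hne : (norm '' shiftRange p).Nonempty := ⟨_, s, hs, rfl⟩
  refine ⟨sSup (norm '' shiftRange p), hs1.trans_le (le_csSup hbdd ⟨s, hs, rfl⟩), ?_, ?_⟩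
  · refine (csSup_le hne ?_).trans_lt (rangeBound_lt_two hp)
    rintro _ ⟨t, ht, rfl⟩
    exact norm_le_of_mem_shiftRange hp ht
  · intro t ht0
    constructor
    · intro ht
      obtain ⟨u, hu, htu⟩ := exists_norm_lt_mem_shiftRange hp ht ht0
      exact htu.trans_le (le_csSup hbdd ⟨u, hu, rfl⟩)
    · intro ht
      obtain ⟨_, ⟨u, hu, rfl⟩, htu⟩ := exists_lt_of_lt_csSup hne ht
      exact mem_shiftRange_of_norm_le hp hu htu.le

/-! ### From zeros of optimal approximants to the shift and back -/

lemma polynomial_mul_mem_space {p : ℝ} (hp : 1 < p) {f : PowerSeries ℂ} (hf : f ∈ space p)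
    (q : Polynomial ℂ) : (q : PowerSeries ℂ) * f ∈ space p := by
  induction q using Polynomial.induction_on' with
  | add q r hq hr =>
    rw [Polynomial.coe_add, add_mul]
    simpa [space] using summable_add hp.le hq hr
  | monomial n c =>
    rw [Polynomial.coe_monomial]
    refine (summable_nat_add_iff n).1 ?_
    simp_rw [PowerSeries.monomial_eq_C_mul_X_pow, mul_assoc, PowerSeries.coeff_C_mul,
      PowerSeries.coeff_X_pow_mul]
    exact summable_const_mul hf c

lemma one_sub_mem_space {p : ℝ} {f : PowerSeries ℂ} (hf : f ∈ space p) : 1 - f ∈ space p := by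
  refine (summable_nat_add_iff 1).1 ((summable_succ (a := fun k => PowerSeries.coeff k f) hf).congr
    fun k => ?_)
  simp [PowerSeries.coeff_one]

lemma pNorm_le_pNorm_iff {p : ℝ} (hp : 1 < p) {f g : PowerSeries ℂ} :
    pNorm p f ≤ pNorm p g ↔
      ∑' k, ‖PowerSeries.coeff k f‖ ^ p ≤ ∑' k, ‖PowerSeries.coeff k g‖ ^ p :=
  Real.rpow_le_rpow_iff (tsum_nonneg fun k => by positivity)
    (tsum_nonneg fun k => by positivity) (by positivity)

lemma isOPA_iff {p : ℝ} (hp : 1 < p) {f : PowerSeries ℂ} {n : ℕ} {q : Polynomial ℂ} :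
    IsOPA p f n q ↔ q ∈ Polynomial.degreeLE ℂ (n : WithBot ℕ) ∧
      ∀ r ∈ Polynomial.degreeLE ℂ (n : WithBot ℕ),
        ∑' k, ‖PowerSeries.coeff k (1 - (q : PowerSeries ℂ) * f)‖ ^ p ≤
          ∑' k, ‖PowerSeries.coeff k (1 - (r : PowerSeries ℂ) * f)‖ ^ p := by
  have hbdd : BddBelow (Set.range fun r : Polynomial.degreeLE ℂ (n : WithBot ℕ) =>
      pNorm p (1 - ((r : Polynomial ℂ) : PowerSeries ℂ) * f)) :=
    ⟨0, by rintro _ ⟨r, rfl⟩; exact Real.rpow_nonneg (tsum_nonneg fun k => by positivity) _⟩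
  simp_rw [← pNorm_le_pNorm_iff hp]
  refine and_congr_right fun hq => ⟨fun h r hr => ?_, fun h => ?_⟩
  · rw [h]
    exact ciInf_le hbdd ⟨r, hr⟩
  · exact le_antisymm (le_ciInf fun r => h r r.2) (ciInf_le hbdd ⟨q, hq⟩)

/-- If `q 0 = 0`, the error has constant term 1, so the zero polynomial does at least as well as
`q`. Criticality there in the direction `f` forces `f 0 = 0`. -/
lemma IsOPA.coeff_zero_ne_zero {p : ℝ} (hp : 1 < p) {f : PowerSeries ℂ} (hf : f ∈ space p)
    (hf0 : PowerSeries.constantCoeff f ≠ 0) {n : ℕ} {q : Polynomial ℂ} (h : IsOPA p f n q) :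
    q.coeff 0 ≠ 0 := by
  intro hq0
  have hp0 : p ≠ 0 := by linarith
  have hmin := ((isOPA_iff hp).1 h).2
  have hone : ∑' k, ‖PowerSeries.coeff k (1 : PowerSeries ℂ)‖ ^ p = 1 := by
    rw [tsum_eq_single 0 fun k hk => by simp [PowerSeries.coeff_one, hk, hp0]]
    simp
  have hs : Summable fun k => ‖PowerSeries.coeff k (1 : PowerSeries ℂ)‖ ^ p :=
    summable_of_ne_finset_zero (s := {0}) fun k hk => by
      simp [PowerSeries.coeff_one, Finset.notMem_singleton.1 hk, hp0]
  have hcrit := tsum_dual_mul_eq_zero hp hs hf fun t => by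
    calc ∑' k, ‖PowerSeries.coeff k (1 : PowerSeries ℂ)‖ ^ p
        = ‖PowerSeries.coeff 0 (1 - (q : PowerSeries ℂ) * f)‖ ^ p := by
          rw [hone]; simp [hq0]
      _ ≤ ∑' k, ‖PowerSeries.coeff k (1 - (q : PowerSeries ℂ) * f)‖ ^ p :=
          Summable.le_tsum (one_sub_mem_space (polynomial_mul_mem_space hp hf q)) 0
            fun k _ => by positivity
      _ ≤ _ := hmin (Polynomial.C (-t)) (Polynomial.mem_degreeLE.2
            (Polynomial.degree_C_le.trans (by exact_mod_cast Nat.zero_le n)))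
      _ = _ := by
          refine tsum_congr fun k => ?_
          rw [Polynomial.coe_C, map_sub, PowerSeries.coeff_C_mul]
          congr 2
          ring
  rw [tsum_eq_single 0 fun k hk => by simp [PowerSeries.coeff_one, hk]] at hcrit
  exact hf0 (by simpa [dual] using hcrit)

lemma inv_mem_shiftRange_of_mem_Omega {p : ℝ} (hp : 1 < p) {z : ℂ} (hz : z ∈ Omega p) :
    z ≠ 0 ∧ z⁻¹ ∈ shiftRange p := by
  obtain ⟨f, hf, hf0, n, hn, q, hq, hqz⟩ := hz
  have hq0 := hq.coeff_zero_ne_zero hp hf hf0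
  have hz0 : z ≠ 0 := by
    rintro rfl
    exact hq0 (by rwa [Polynomial.coeff_zero_eq_eval_zero])
  refine ⟨hz0, ?_⟩
  obtain ⟨r, rfl⟩ := Polynomial.dvd_iff_isRoot.2 hqz
  rw [isOPA_iff hp] at hq
  obtain ⟨hdeg, hmin⟩ := hq
  rw [Polynomial.mem_degreeLE, Polynomial.degree_mul, Polynomial.degree_X_sub_C] at hdeg
  have hg : (r : PowerSeries ℂ) * f ∈ space p := polynomial_mul_mem_space hp hf r
  set g := (r : PowerSeries ℂ) * f with hgdef
  refine ⟨fun k => PowerSeries.coeff k g, hg, ?_, fun t => ?_⟩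
  · have hr0 : r.coeff 0 ≠ 0 := fun h => hq0 (by simp [Polynomial.mul_coeff_zero, h])
    simpa [hgdef] using And.intro hr0 hf0
  -- These competitors keep the constant term of the error fixed; its other coefficients are `-z`
  -- times those of `S g - t g`.
  have h := hmin ((Polynomial.C (t * z) * Polynomial.X - Polynomial.C z) * r) (by
    rw [Polynomial.mem_degreeLE, Polynomial.degree_mul]
    refine le_trans ?_ hdeg
    gcongr
    rw [sub_eq_add_neg, ← Polynomial.C_neg]
    exact Polynomial.degree_linear_le)
  have e : ∀ s : ℂ, 1 - (((Polynomial.C s * Polynomial.X - Polynomial.C z) * r : Polynomial ℂ) :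
      PowerSeries ℂ) * f = 1 - PowerSeries.C s * (PowerSeries.X * g) + PowerSeries.C z * g := by
    intro s
    rw [hgdef]
    push_cast
    ring
  have hsum : ∀ s : ℂ, ∑' k, ‖PowerSeries.coeff k
      (1 - PowerSeries.C (s * z) * (PowerSeries.X * g) + PowerSeries.C z * g)‖ ^ p =
      ‖1 + z * PowerSeries.constantCoeff g‖ ^ p +
        ‖z‖ ^ p * ∑' k, ‖PowerSeries.coeff (k + 1) g - s * PowerSeries.coeff k g‖ ^ p := by
    intro s
    have hmem : 1 - PowerSeries.C (s * z) * (PowerSeries.X * g) + PowerSeries.C z * g ∈ space p := by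
      rw [← e]
      exact one_sub_mem_space (polynomial_mul_mem_space hp hf _)
    rw [Summable.tsum_eq_zero_add hmem, ← tsum_mul_left]
    refine congrArg₂ _ (by simp) (tsum_congr fun k => ?_)
    rw [← Real.mul_rpow (norm_nonneg _) (norm_nonneg _), ← norm_mul]
    congr 2
    simp only [map_add, map_sub, PowerSeries.coeff_C_mul, PowerSeries.coeff_succ_X_mul,
      PowerSeries.coeff_one]
    simp
    ring
  have hX : (Polynomial.X - Polynomial.C z : Polynomial ℂ) =
      Polynomial.C (z⁻¹ * z) * Polynomial.X - Polynomial.C z := by simp [hz0]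
  rw [hX, e, e, hsum, hsum] at h
  exact le_of_mul_le_mul_left (by linarith) (Real.rpow_pos_of_pos (norm_pos_iff.2 hz0) p)

lemma mem_Omega_of_inv_mem_shiftRange {p : ℝ} (hp : 1 < p) {z : ℂ} (hz0 : z ≠ 0)
    (hz : z⁻¹ ∈ shiftRange p) : z ∈ Omega p := by
  obtain ⟨a, ha, ha0, h⟩ := hz
  -- This `w` makes the error `G = c - (X - z) a` satisfy the critical equation against `a`; the one
  -- against `X a` is the optimality of `z⁻¹`.
  obtain ⟨w, hw⟩ := exists_dual_eq hp
    (-(∑' k, dual p (z * a (k + 1) - a k) * a (k + 1)) / a 0)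
  let G : ℕ → ℂ := fun k => Nat.casesOn k w fun j => z * a (j + 1) - a j
  let b : ℕ → ℂ := fun k => Nat.casesOn k 0 a
  have hb : Summable fun k => ‖b k‖ ^ p := (summable_nat_add_iff 1).1 ha
  have hG : Summable fun k => ‖G k‖ ^ p := by
    refine (summable_nat_add_iff 1).1 ?_
    simpa using summable_sub_mul hp.le (summable_const_mul (summable_succ ha) z) ha 1
  have hGa : ∑' k, dual p (G k) * a k = 0 := by
    rw [(summable_dual_mul hp hG ha).tsum_eq_zero_add]
    change dual p w * a 0 + ∑' k, dual p (z * a (k + 1) - a k) * a (k + 1) = 0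
    rw [hw, div_mul_cancel₀ _ ha0]
    ring
  have hGb : ∑' k, dual p (G k) * b k = 0 := by
    rw [(summable_dual_mul hp hG hb).tsum_eq_zero_add]
    change dual p w * 0 + ∑' k, dual p (z * a (k + 1) - a k) * a k = 0
    have e : ∀ k, dual p (z * a (k + 1) - a k) * a k =
        dual p z * (dual p (a (k + 1) - z⁻¹ * a k) * a k) := fun k => by
      rw [← mul_assoc, ← dual_mul]
      congr 2
      field_simp
    simp_rw [e, tsum_mul_left, h.tsum_dual_eq_zero hp ha]
    ring
  have hGmin : ∀ u v : ℂ, ∑' k, ‖G k‖ ^ p ≤ ∑' k, ‖G k + (u * a k + v * b k)‖ ^ p := by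
    intro u v
    have hua := summable_const_mul ha u
    have hvb := summable_const_mul hb v
    have h1 := tsum_norm_rpow_add_re_dual_le hp hG (summable_add hp.le hua hvb)
    have h2 : ∑' k, dual p (G k) * (u * a k + v * b k) = 0 := by
      simp_rw [mul_add]
      rw [(summable_dual_mul hp hG hua).tsum_add (summable_dual_mul hp hG hvb)]
      simp_rw [mul_left_comm _ u, mul_left_comm _ v, tsum_mul_left, hGa, hGb]
      ring
    simpa [h2] using h1
  set c := w - z * a 0 with hc
  have hGc : ∀ k, G k + (-z * a k + 1 * b k) = if k = 0 then c else 0 := by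
    intro k
    cases k with
    | zero => simp [G, b, hc]; ring
    | succ k => simp [G, b]
  -- If `c = 0`, then `G` lies in the span of `a` and `X a`, so its minimality forces `G = 0`, hence
  -- `w = 0` and `c = -z * a 0 ≠ 0`.
  have hc0 : c ≠ 0 := by
    intro hc0
    have h1 := hGmin (-z) 1
    simp only [hGc, hc0, ite_self, norm_zero, Real.zero_rpow (by linarith : p ≠ 0), tsum_zero] at h1
    have h2 := (hG.le_tsum 0 fun k _ => by positivity).trans h1
    have h3 : w = 0 := by
      by_contra hw0
      exact (Real.rpow_pos_of_pos (norm_pos_iff.2 hw0) p).not_ge h2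
    rw [h3, zero_sub] at hc
    exact mul_ne_zero hz0 ha0 (neg_eq_zero.1 (hc.symm.trans hc0))
  have hcoeff : ∀ u v : ℂ, ∀ k, PowerSeries.coeff k
      (1 - ((Polynomial.C v * Polynomial.X + Polynomial.C u : Polynomial ℂ) : PowerSeries ℂ) *
        PowerSeries.mk fun k => c⁻¹ * a k) = c⁻¹ * (G k + ((-z - u) * a k + (1 - v) * b k)) := by
    intro u v k
    have h1 : G k + ((-z - u) * a k + (1 - v) * b k) =
        (if k = 0 then c else 0) - (u * a k + v * b k) := by
      rw [← hGc]
      ring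
    rw [h1]
    push_cast
    rw [add_mul, mul_assoc]
    simp only [map_sub, map_add, PowerSeries.coeff_C_mul, PowerSeries.coeff_one]
    cases k with
    | zero => simp [b]; field_simp
    | succ k => simp [b, PowerSeries.coeff_succ_X_mul]; ring
  have hX : (Polynomial.X - Polynomial.C z : Polynomial ℂ) =
      Polynomial.C 1 * Polynomial.X + Polynomial.C (-z) := by simp [sub_eq_add_neg]
  refine ⟨PowerSeries.mk fun k => c⁻¹ * a k, ?_, ?_, 1, le_rfl, Polynomial.X - Polynomial.C z,
    (isOPA_iff hp).2 ⟨?_, fun r hr => ?_⟩, by simp⟩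
  · simpa [space] using summable_const_mul ha c⁻¹
  · simpa [← PowerSeries.coeff_zero_eq_constantCoeff_apply] using And.intro hc0 ha0
  · rw [Polynomial.mem_degreeLE, Polynomial.degree_X_sub_C]
    rfl
  · rw [Polynomial.eq_X_add_C_of_degree_le_one (Polynomial.mem_degreeLE.1 hr), hX]
    simp_rw [hcoeff, norm_mul, Real.mul_rpow (norm_nonneg _) (norm_nonneg _), tsum_mul_left]
    refine mul_le_mul_of_nonneg_left ?_ (by positivity)
    simpa using hGmin (-z - r.coeff 0) (1 - r.coeff 1)

lemma mem_Omega_iff {p : ℝ} (hp : 1 < p) {z : ℂ} :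
    z ∈ Omega p ↔ z ≠ 0 ∧ z⁻¹ ∈ shiftRange p :=
  ⟨inv_mem_shiftRange_of_mem_Omega hp, fun h => mem_Omega_of_inv_mem_shiftRange hp h.1 h.2⟩

end EllA

theorem theorem1p2 (p : ℝ) (hp : 1 < p) (hp2 : p ≠ 2) :
    ∃ τ : ℝ, 1 < τ ∧ τ < 2 ∧
      EllA.Omega p = (Metric.closedBall (0 : ℂ) (1 / τ))ᶜ ∧
      EllA.Omega p ∩ Metric.ball (0 : ℂ) 1 = {z : ℂ | 1 / τ < ‖z‖ ∧ ‖z‖ < 1} ∧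
      IsOpen (EllA.Omega p) := by
  obtain ⟨τ, h1, h2, hτ⟩ := EllA.exists_mem_shiftRange_iff_norm_lt hp hp2
  have hτ0 : 0 < τ := by linarith
  have hmem : ∀ z : ℂ, z ∈ EllA.Omega p ↔ 1 / τ < ‖z‖ := by
    intro z
    rw [EllA.mem_Omega_iff hp]
    constructor
    · rintro ⟨hz0, hz⟩
      rw [hτ _ (inv_ne_zero hz0), norm_inv] at hz
      rw [one_div]
      exact inv_lt_of_inv_lt₀ (norm_pos_iff.2 hz0) hz
    · intro hz
      have hz0 : 0 < ‖z‖ := lt_trans (by positivity) hz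
      refine ⟨norm_pos_iff.1 hz0, ?_⟩
      rw [hτ _ (inv_ne_zero (norm_pos_iff.1 hz0)), norm_inv]
      rw [one_div] at hz
      exact inv_lt_of_inv_lt₀ hτ0 hz
  have heq : EllA.Omega p = (Metric.closedBall (0 : ℂ) (1 / τ))ᶜ := by
    ext z
    simp [hmem]
  refine ⟨τ, h1, h2, heq, ?_, heq ▸ Metric.isClosed_closedBall.isOpen_compl⟩
  ext z
  simp [hmem]
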